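/- For integers $1 \le k \le r$, an $(r,k)$-colouring of a graph $G$ assigns to every edge of $G$ a $k$-element subset of the colour set $\{1,\dots,r\}$. The set-Ramsey number $R_{r,k}(H)$ of a finite graph $H$ is the smallest $n$ such that every $(r,k)$-colouring of the complete graph $K_n$ contains a monochromatic copy of $H$, that is, a subgraph of $K_n$ isomorphic to $H$ for which some single colour belongs to the colour sets of all its edges. Let $C_\ell$ denote the cycle of length $\ell$. **Proposition.** For every odd $\ell \ge 3$ there are real numbers $\varepsilon = \varepsilon(\ell) > 0$ and $f = f(\ell) > 1$, depending only on $\ell$, such that for every integer $k \ge 2$ there is an $r_0 = r_0(k,\ell)$ such that $$R_{r,k}(C_\ell) > (2+\varepsilon)^{r-f}(\ell-1) \qquad \text{for all integers } r \ge r_0.$$ -/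

import Mathlib

open Filter SimpleGraph

/-- An `(r,k)`-colouring of a graph `G`: a map from the edges of `G` to the `k`-element subsets
of the set of `r` colours `Fin r`. -/
def SetColouring {V : Type*} (G : SimpleGraph V) (r k : ℕ) : Type _ :=
  G.edgeSet → {s : Finset (Fin r) // s.card = k}

/-- The spanning subgraph of `G` formed by the edges whose colour set contains the colour `i`. -/
def SetColouring.colourGraph {V : Type*} {G : SimpleGraph V} {r k : ℕ}
    (φ : SetColouring G r k) (i : Fin r) : SimpleGraph V where
  Adj u v := ∃ h : s(u, v) ∈ G.edgeSet, i ∈ (φ ⟨s(u, v), h⟩).1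
  symm := ⟨by
    rintro u v ⟨h, hi⟩
    have e : s(v, u) = s(u, v) := Sym2.eq_swap
    rw [e]
    exact ⟨h, hi⟩⟩
  loopless := ⟨by
    rintro u ⟨h, -⟩
    exact G.irrefl ((SimpleGraph.mem_edgeSet G).1 h)⟩

/-- The colouring contains a monochromatic copy of `H`: a (not necessarily induced) copy of `H`
in `G` such that some single colour appears on all of its edges. -/
def SetColouring.HasMonoCopy {V W : Type*} {G : SimpleGraph V} {r k : ℕ}
    (φ : SetColouring G r k) (H : SimpleGraph W) : Prop :=
  ∃ i : Fin r, H.IsContained (φ.colourGraph i)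

/-- The set of all `n` such that every `(r,k)`-colouring of the complete graph `K_n` contains a
monochromatic copy of `H`. -/
def setRamseySet {W : Type*} (r k : ℕ) (H : SimpleGraph W) : Set ℕ :=
  {n | ∀ φ : SetColouring (completeGraph (Fin n)) r k, φ.HasMonoCopy H}

/-- The set-Ramsey number: the smallest `n` such that every `(r,k)`-colouring of `K_n` contains a
monochromatic copy of `H`. The minimum is over a nonempty set when `k ≥ 1` and `H` is finite, see
`setRamseySet_nonempty`. -/
noncomputable def setRamsey {W : Type*} (r k : ℕ) (H : SimpleGraph W) : ℕ :=
  sInf (setRamseySet r k H)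

/-- In a coloured large finite set there is a sequence of `m` distinct points such that the colour
of a pair depends only on the earlier point. -/
theorem exists_prehomogeneous (r m : ℕ) : ∃ N : ℕ, ∀ {V : Type} [DecidableEq V] (A : Finset V)
    (c : V → V → Fin r), N ≤ A.card → ∃ (f : Fin m → V) (d : Fin m → Fin r),
      Function.Injective f ∧ (∀ i, f i ∈ A) ∧ ∀ i j, i < j → c (f i) (f j) = d i := by
  induction m with
  | zero => exact ⟨0, fun A c _ => ⟨Fin.elim0, Fin.elim0, fun i => i.elim0, fun i => i.elim0,
      fun i => i.elim0⟩⟩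
  | succ m ih =>
    obtain ⟨N, hN⟩ := ih
    refine ⟨r * N + 1, ?_⟩
    intro V _ A c hA
    obtain ⟨x, hx⟩ : A.Nonempty := Finset.card_pos.1 (by omega)
    have hcard : (Finset.univ : Finset (Fin r)).card * N ≤ (A.erase x).card := by
      rw [Finset.card_erase_of_mem hx, Finset.card_univ, Fintype.card_fin]
      omega
    obtain ⟨y, -, hy⟩ := Finset.exists_le_card_fiber_of_mul_le_card_of_maps_to
      (s := A.erase x) (t := Finset.univ) (f := c x) (fun _ _ => Finset.mem_univ _)
      ⟨c x x, Finset.mem_univ _⟩ hcard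
    obtain ⟨f, d, hf, hfA, hfd⟩ := hN _ c hy
    have hmem : ∀ i, f i ≠ x ∧ f i ∈ A ∧ c x (f i) = y := by
      intro i
      have := hfA i
      simp only [Finset.mem_filter, Finset.mem_erase] at this
      exact ⟨this.1.1, this.1.2, this.2⟩
    refine ⟨Fin.cons x f, Fin.cons y d, ?_, ?_, ?_⟩
    · rw [Fin.cons_injective_iff]
      refine ⟨?_, hf⟩
      rintro ⟨i, hi⟩
      exact (hmem i).1 hi
    · intro i
      refine Fin.cases hx (fun i => (hmem i).2.1) i
    · intro i j
      refine Fin.cases ?_ (fun i => ?_) i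
      · refine Fin.cases ?_ (fun j => ?_) j
        · intro h
          exact absurd h (lt_irrefl _)
        · intro _
          simpa using (hmem j).2.2
      · refine Fin.cases ?_ (fun j => ?_) j
        · intro h
          exact absurd h (Fin.not_lt_zero _)
        · intro h
          simpa using hfd i j (Fin.succ_lt_succ_iff.1 h)

/-- The set-Ramsey number is well defined: for `k ≥ 1` and finite `H`, some complete graph has the
required property. -/
theorem setRamseySet_nonempty {W : Type*} [Fintype W] (r k : ℕ) (hk : 1 ≤ k)
    (H : SimpleGraph W) : (setRamseySet r k H).Nonempty := by
  classical
  obtain ⟨N, hN⟩ := exists_prehomogeneous r (r * Fintype.card W)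
  refine ⟨N + 2, fun φ => ?_⟩
  have hne : ∀ e, ∃ i, i ∈ (φ e).1 := by
    intro e
    exact Finset.card_pos.1 (by rw [(φ e).2]; omega)
  choose g hg using hne
  have hadj : ∀ {u v : Fin (N + 2)}, u ≠ v →
      s(u, v) ∈ (completeGraph (Fin (N + 2))).edgeSet := by
    intro u v h
    simpa using h
  let z : Fin r := g ⟨s(0, 1), hadj (by simp)⟩
  let c : Fin (N + 2) → Fin (N + 2) → Fin r := fun u v =>
    if h : u ≠ v then g ⟨s(u, v), hadj h⟩ else z
  obtain ⟨f, d, hf, -, hfd⟩ := hN Finset.univ c (by simp)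
  obtain ⟨i, -, hi⟩ := Finset.exists_le_card_fiber_of_mul_le_card_of_maps_to
      (s := Finset.univ) (t := Finset.univ) (f := d) (n := Fintype.card W)
      (fun _ _ => Finset.mem_univ _) ⟨z, Finset.mem_univ _⟩ (by simp)
  have hlt : ∀ p q, p < q → d p = i → (φ.colourGraph i).Adj (f p) (f q) := by
    intro p q hpq hp
    have hne : f p ≠ f q := fun h => hpq.ne (hf h)
    refine ⟨hadj hne, ?_⟩
    have h1 := hfd p q hpq
    rw [hp] at h1
    simp only [c, dif_pos hne] at h1
    rw [← h1]
    exact hg _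
  obtain ⟨e⟩ : Nonempty (W ↪ {p // p ∈ Finset.univ.filter (fun p => d p = i)}) :=
    Function.Embedding.nonempty_of_card_le (by simpa [Fintype.card_subtype] using hi)
  have he : ∀ w, d (e w).1 = i := fun w => (Finset.mem_filter.1 (e w).2).2
  refine ⟨i, ⟨⟨⟨fun w => f (e w).1, ?_⟩, ?_⟩⟩⟩
  · intro a b hab
    have hab' : (e a).1 ≠ (e b).1 := fun h => hab.ne (e.injective (Subtype.ext h))
    rcases lt_or_gt_of_ne hab' with h | h
    · exact hlt _ _ h (he a)
    · exact (hlt _ _ h (he b)).symm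
  · intro a b hab
    exact e.injective (Subtype.ext (hf hab))

/-- The set-Ramsey number attains the minimum in its definition. -/
theorem isLeast_setRamsey {W : Type*} [Fintype W] (r k : ℕ) (hk : 1 ≤ k) (H : SimpleGraph W) :
    IsLeast (setRamseySet r k H) (setRamsey r k H) :=
  ⟨Nat.sInf_mem (setRamseySet_nonempty r k hk H), fun _ hn => Nat.sInf_le hn⟩

/-! Binary words of length `r`, coloured by a differing place, give bipartite colour classes and
about `2 ^ r` vertices. To beat the base 2, `2 ^ d + 1` vertices are coloured with `d` colours, each
mapping homomorphically to an odd cycle longer than `ℓ`, which has no closed walk of length `ℓ`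
(`not_forall_cycAdj`). `IsSpreading.double` builds `2 ^ d` words over a path; the constant word 0 is
the extra vertex, as the letter 0 joins both ends of the path into an odd cycle
(`exists_cycAdj_words`). Products of this colouring use `d` fresh colours per place. Restricting to
a code of distance `k` (`exists_code`) gives each pair `k` colours and costs only a polynomial
factor in `r`, so the base `(2 ^ d + 1) ^ (1 / d) > 2` depends on `ℓ` alone, up to an arbitrarily
small loss. -/

/-! ### Spreading words over a path -/

/-- A labelling of the points of `X` by words over the alphabet `ι` whose letters are vertices of
the path `1, …, 2n+2`: any two words have adjacent letters in some place, and every word has a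
letter that is an end of the path, the end being recorded by `u`. -/
structure IsSpreading (n : ℕ) {X ι : Type} (p : X → ι → ℤ) (u : X → Bool) : Prop where
  one_le : ∀ x i, 1 ≤ p x i
  le : ∀ x i, p x i ≤ 2 * n + 2
  bot : ∀ x, u x = true → ∃ i, p x i = 1
  top : ∀ x, u x = false → ∃ i, p x i = 2 * n + 2
  adj : ∀ x y, x ≠ y → ∃ i, p y i - p x i = 1 ∨ p y i - p x i = -1
  ahead : ∀ x y, u x = true → u y = false → ∃ i, p y i - p x i = 1 ∨ p y i - p x i = 3

/-- The labelling of `X × X` obtained by shifting each of the two words by `0` or `2`, as the end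
met by the other word prescribes. -/
def doubleLabel {X ι : Type} (p : X → ι → ℤ) (u : X → Bool) (z : X × X) : ι ⊕ ι → ℤ :=
  Sum.elim (fun i => p z.1 i + if u z.2 then 2 else 0) (fun i => p z.2 i + if u z.1 then 0 else 2)

/-- Points double in exponent just as places do, while the path grows by 2. If the end marks agree
in one factor, the shifts cancel in the other and `adj` persists there. If both marks differ, a
relative shift by 2 turns the differences 1, 3 of `ahead` into -1, 1; this is why `ahead` is carried
along. It is inherited since the shift also turns -1, 1 into 1, 3. -/
theorem IsSpreading.double {n : ℕ} {X ι : Type} {p : X → ι → ℤ} {u : X → Bool}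
    (h : IsSpreading n p u) : IsSpreading (n + 1) (doubleLabel p u) (fun z => u z.1) where
  one_le := by
    rintro ⟨x, y⟩ (i | i)
    · have := h.one_le x i
      simp only [doubleLabel, Sum.elim_inl]; split_ifs <;> omega
    · have := h.one_le y i
      simp only [doubleLabel, Sum.elim_inr]; split_ifs <;> omega
  le := by
    rintro ⟨x, y⟩ (i | i)
    · have := h.le x i
      simp only [doubleLabel, Sum.elim_inl]; split_ifs <;> push_cast <;> omega
    · have := h.le y i
      simp only [doubleLabel, Sum.elim_inr]; split_ifs <;> push_cast <;> omega
  bot := by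
    rintro ⟨x, y⟩ hx
    cases hy : u y
    · obtain ⟨i, hi⟩ := h.bot x hx
      exact ⟨.inl i, by simp [doubleLabel, hy, hi]⟩
    · obtain ⟨i, hi⟩ := h.bot y hy
      exact ⟨.inr i, by simp_all [doubleLabel]⟩
  top := by
    rintro ⟨x, y⟩ hx
    cases hy : u y
    · obtain ⟨i, hi⟩ := h.top y hy
      exact ⟨.inr i, by simp_all [doubleLabel]; ring⟩
    · obtain ⟨i, hi⟩ := h.top x hx
      exact ⟨.inl i, by simp_all [doubleLabel]; ring⟩
  adj := by
    rintro ⟨x, y⟩ ⟨x', y'⟩ hne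
    by_cases hx : u x = u x'
    · by_cases hy : u y = u y'
      · by_cases hxx : x = x'
        · have hyy : y ≠ y' := fun e => hne (by rw [hxx, e])
          obtain ⟨i, hi⟩ := h.adj y y' hyy
          exact ⟨.inr i, by simpa [doubleLabel, hx] using hi⟩
        · obtain ⟨i, hi⟩ := h.adj x x' hxx
          exact ⟨.inl i, by simpa [doubleLabel, hy] using hi⟩
      · obtain ⟨i, hi⟩ := h.adj y y' (fun e => hy (by rw [e]))
        exact ⟨.inr i, by simpa [doubleLabel, hx] using hi⟩
    · by_cases hy : u y = u y'
      · obtain ⟨i, hi⟩ := h.adj x x' (fun e => hx (by rw [e]))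
        exact ⟨.inl i, by simpa [doubleLabel, hy] using hi⟩
      · cases hux : u x <;> cases hux' : u x' <;> cases huy : u y <;> cases huy' : u y' <;>
          simp only [hux, hux', huy, huy', not_true, reduceCtorEq, not_false_eq_true] at hx hy
        · obtain ⟨i, hi⟩ := h.ahead x' x hux' hux
          exact ⟨.inl i, by simp only [doubleLabel, Sum.elim_inl, huy, huy']; simp; omega⟩
        · obtain ⟨i, hi⟩ := h.ahead y y' huy huy'
          exact ⟨.inr i, by simp only [doubleLabel, Sum.elim_inr, hux, hux']; simp; omega⟩
        · obtain ⟨i, hi⟩ := h.ahead y' y huy' huy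
          exact ⟨.inr i, by simp only [doubleLabel, Sum.elim_inr, hux, hux']; simp; omega⟩
        · obtain ⟨i, hi⟩ := h.ahead x x' hux hux'
          exact ⟨.inl i, by simp only [doubleLabel, Sum.elim_inl, huy, huy']; simp; omega⟩
  ahead := by
    rintro ⟨x, y⟩ ⟨x', y'⟩ (hx : u x = true) (hx' : u x' = false)
    cases huy : u y <;> cases huy' : u y'
    · obtain ⟨i, hi⟩ := h.ahead x x' hx hx'
      exact ⟨.inl i, by simp only [doubleLabel, Sum.elim_inl, huy, huy']; simp; omega⟩
    · obtain ⟨i, hi⟩ := h.adj x x' (fun e => by rw [e, hx'] at hx; cases hx)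
      exact ⟨.inl i, by simp only [doubleLabel, Sum.elim_inl, huy, huy']; simp; omega⟩
    · obtain ⟨i, hi⟩ := h.adj y y' (fun e => by rw [e, huy'] at huy; cases huy)
      exact ⟨.inr i, by simp only [doubleLabel, Sum.elim_inr, hx, hx']; simp; omega⟩
    · obtain ⟨i, hi⟩ := h.ahead x x' hx hx'
      exact ⟨.inl i, by simp only [doubleLabel, Sum.elim_inl, huy, huy']; simp; omega⟩

theorem isSpreading_bool :
    IsSpreading 0 (fun (b : Bool) (_ : Unit) => if b then (1 : ℤ) else 2) id where
  one_le := by rintro (_ | _) _ <;> simp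
  le := by rintro (_ | _) _ <;> simp
  bot := by rintro (_ | _) h <;> simp_all
  top := by rintro (_ | _) h <;> simp_all
  adj := by rintro (_ | _) (_ | _) h <;> simp_all
  ahead := by rintro (_ | _) (_ | _) h h' <;> simp_all

theorem exists_isSpreading (n : ℕ) : ∃ (X ι : Type) (_ : Fintype X) (_ : Fintype ι)
    (_ : Nonempty ι) (p : X → ι → ℤ) (u : X → Bool),
    Fintype.card X = 2 ^ Fintype.card ι ∧ IsSpreading n p u := by
  induction n with
  | zero => exact ⟨Bool, Unit, inferInstance, inferInstance, inferInstance, _, _, by simp,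
      isSpreading_bool⟩
  | succ n ih =>
    obtain ⟨X, ι, _, _, _, p, u, hc, h⟩ := ih
    refine ⟨X × X, ι ⊕ ι, inferInstance, inferInstance, inferInstance, _, _, ?_, h.double⟩
    rw [Fintype.card_prod, Fintype.card_sum, hc, pow_add]

/-! ### Odd cycles -/

/-- Adjacency of the residues of `a` and `b` on the cycle of length `m`. -/
def CycAdj (m : ℕ) (a b : ℤ) : Prop := ∃ e : ℤ, (e = 1 ∨ e = -1) ∧ (m : ℤ) ∣ b - a - e

theorem CycAdj.symm {m : ℕ} {a b : ℤ} (h : CycAdj m a b) : CycAdj m b a := by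
  obtain ⟨e, he, hd⟩ := h
  refine ⟨-e, by omega, ?_⟩
  have := (dvd_neg (α := ℤ)).2 hd
  rwa [show a - b - -e = -(b - a - e) by ring]

/-- There are `2 ^ d + 1` words of length `d` over a long odd cycle, any two of which have adjacent
letters in some place. -/
theorem exists_cycAdj_words (n : ℕ) : ∃ (Y ι : Type) (_ : Fintype Y) (_ : Fintype ι)
    (_ : Nonempty ι) (q : Y → ι → ℤ), Fintype.card Y = 2 ^ Fintype.card ι + 1 ∧
    ∀ x y, x ≠ y → ∃ i, CycAdj (2 * n + 3) (q x i) (q y i) := by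
  obtain ⟨X, ι, _, _, _, p, u, hc, h⟩ := exists_isSpreading n
  have key : ∀ x, ∃ i, CycAdj (2 * n + 3) 0 (p x i) := by
    intro x
    cases hx : u x
    · obtain ⟨i, hi⟩ := h.top x hx
      exact ⟨i, -1, .inr rfl, 1, by rw [hi]; push_cast; ring⟩
    · obtain ⟨i, hi⟩ := h.bot x hx
      exact ⟨i, 1, .inl rfl, 0, by rw [hi]; ring⟩
  refine ⟨Option X, ι, inferInstance, inferInstance, inferInstance,
    fun y i => y.elim 0 (fun x => p x i), by rw [Fintype.card_option, hc], ?_⟩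
  rintro (_ | x) (_ | y) hne
  · exact absurd rfl hne
  · exact key y
  · obtain ⟨i, hi⟩ := key x
    exact ⟨i, hi.symm⟩
  · obtain ⟨i, hi⟩ := h.adj x y (fun e => hne (by rw [e]))
    exact ⟨i, _, hi, by simp⟩

/-- A cycle has no closed walk of odd length shorter than itself. -/
theorem not_forall_cycAdj {m l : ℕ} [NeZero l] (hl : Odd l) (hlm : l < m) (f : Fin l → ℤ) :
    ¬ ∀ j, CycAdj m (f j) (f (j + 1)) := by
  intro h
  choose e he hd using h
  have hsum : ∑ j, (f (j + 1) - f j - e j) = - ∑ j, e j := by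
    rw [Finset.sum_sub_distrib, Finset.sum_sub_distrib,
      show ∑ j, f (j + 1) = ∑ j, f j from Equiv.sum_comp (Equiv.addRight (1 : Fin l)) f]
    ring
  have hdvd : (m : ℤ) ∣ ∑ j, e j := by
    rw [← dvd_neg, ← hsum]
    exact Finset.dvd_sum fun j _ => hd j
  have habs : |∑ j, e j| < m := by
    calc |∑ j, e j| ≤ ∑ j, |e j| := Finset.abs_sum_le_sum_abs _ _
      _ = ∑ _j : Fin l, (1 : ℤ) := Finset.sum_congr rfl fun j _ => by
          rcases he j with h | h <;> simp [h]
      _ < m := by simpa using hlm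
  have hzero := Int.eq_zero_of_abs_lt_dvd hdvd habs
  -- A sum of `l` signs has the parity of `l`, so it cannot vanish.
  have hcast : (((∑ j, e j : ℤ)) : ZMod 2) = l := by
    push_cast
    rw [Finset.sum_congr rfl (g := fun _ => (1 : ZMod 2)) fun j _ => by
      rcases he j with h | h <;> simp [h]]
    simp
  rw [hzero, Int.cast_zero, eq_comm, ZMod.natCast_eq_zero_iff] at hcast
  obtain ⟨c, rfl⟩ := hl
  omega

/-! ### From relations to set-colourings -/

/-- A covering of the pairs of points by at least `k` of `r` symmetric relations without closed
walks of length `l` bounds the set-Ramsey number of the cycle from below. -/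
theorem card_lt_setRamsey_cycleGraph {V : Type} [Fintype V] {r k l : ℕ} (hk : 1 ≤ k) (hl : 3 ≤ l)
    [NeZero l] (R : Fin r → V → V → Prop) (hsymm : ∀ c v w, R c v w → R c w v)
    (hcov : ∀ v w, v ≠ w → ∃ s : Finset (Fin r), s.card = k ∧ ∀ c ∈ s, R c v w)
    (hfree : ∀ c (f : Fin l → V), ¬ ∀ j, R c (f j) (f (j + 1))) :
    Fintype.card V < setRamsey r k (cycleGraph l) := by
  have hmem := (isLeast_setRamsey r k hk (cycleGraph l)).1
  set n := setRamsey r k (cycleGraph l) with hn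
  by_contra! hle
  obtain ⟨g⟩ : Nonempty (Fin n ↪ V) := Function.Embedding.nonempty_of_card_le (by simpa using hle)
  have hedge : ∀ e : (completeGraph (Fin n)).edgeSet, ∃ s : Finset (Fin r), s.card = k ∧
      ∀ c ∈ s, ∀ u v, e.1 = s(u, v) → R c (g u) (g v) := by
    rintro ⟨e, he⟩
    induction e using Sym2.ind with
    | _ a b =>
      have hab : a ≠ b := by simpa using he
      obtain ⟨s, hs, hR⟩ := hcov (g a) (g b) (g.injective.ne hab)
      refine ⟨s, hs, fun c hc u v huv => ?_⟩
      rcases Sym2.eq_iff.1 huv with ⟨rfl, rfl⟩ | ⟨rfl, rfl⟩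
      · exact hR c hc
      · exact hsymm _ _ _ (hR c hc)
  choose S hS hSR using hedge
  obtain ⟨c, ⟨φ⟩⟩ := hmem (fun e => ⟨S e, hS e⟩)
  refine hfree c (fun j => g (φ j)) fun j => ?_
  have hadj : (cycleGraph l).Adj j (j + 1) := by
    obtain ⟨l, rfl⟩ : ∃ t, l = t + 2 := ⟨l - 2, by omega⟩
    rw [cycleGraph_adj]
    right
    simp
  obtain ⟨he, hc⟩ := φ.toHom.map_adj hadj
  exact hSR _ c hc _ _ rfl

/-! ### Codes -/

/-- A Hamming ball of radius `k` has at most `(m |Y| + 1) ^ k` points. -/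
theorem card_hammingBall_le {Y : Type} [Fintype Y] [DecidableEq Y] {m : ℕ} (v : Fin m → Y)
    (k : ℕ) : (Finset.univ.filter fun w => hammingDist v w ≤ k).card ≤
      (m * Fintype.card Y + 1) ^ k := by
  induction k with
  | zero =>
    rw [pow_zero, Finset.card_le_one]
    intro a ha b hb
    simp only [Finset.mem_filter, Finset.mem_univ, true_and, nonpos_iff_eq_zero,
      hammingDist_eq_zero] at ha hb
    rw [← ha, ← hb]
  | succ k ih =>
    -- Rewrites at most one letter; `none` leaves the word alone.
    let g : (Fin m → Y) × Option (Fin m × Y) → (Fin m → Y) :=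
      fun z => z.2.elim z.1 fun o => Function.update z.1 o.1 o.2
    have hsub : (Finset.univ.filter fun w => hammingDist v w ≤ k + 1) ⊆
        ((Finset.univ.filter fun w => hammingDist v w ≤ k) ×ˢ Finset.univ).image g := by
      intro w hw
      simp only [Finset.mem_filter, Finset.mem_univ, true_and] at hw
      simp only [Finset.mem_image, Finset.mem_product, Finset.mem_filter, Finset.mem_univ,
        true_and, and_true]
      by_cases hk : hammingDist v w ≤ k
      · exact ⟨(w, none), hk, rfl⟩
      · have hne : v ≠ w := fun e => hk (by rw [e, hammingDist_self]; exact k.zero_le)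
        obtain ⟨a, ha⟩ := Function.ne_iff.1 hne
        refine ⟨(Function.update w a (v a), some (a, w a)), ?_, by simp [g]⟩
        have hlt : hammingDist v (Function.update w a (v a)) < hammingDist v w := by
          refine Finset.card_lt_card (Finset.ssubset_iff_subset_ne.2 ⟨fun b hb => ?_, fun e => ?_⟩)
          · by_cases hba : b = a
            · subst hba; simp at hb
            · simpa [hba] using hb
          · have : a ∈ Finset.univ.filter fun i => v i ≠ w i := by simpa using ha
            rw [← e] at this
            simp at this
        simp only
        omega
    calc _ ≤ _ := Finset.card_le_card hsub
      _ ≤ _ := Finset.card_image_le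
      _ = (Finset.univ.filter fun w => hammingDist v w ≤ k).card * (m * Fintype.card Y + 1) := by
        rw [Finset.card_product, Finset.card_univ, Fintype.card_option, Fintype.card_prod,
          Fintype.card_fin]
      _ ≤ _ := by rw [pow_succ]; exact Nat.mul_le_mul_right _ ih

/-- The Gilbert–Varshamov bound, in a weak form. -/
theorem exists_code (Y : Type) [Fintype Y] [DecidableEq Y] (m k : ℕ) :
    ∃ C : Finset (Fin m → Y), (∀ v ∈ C, ∀ w ∈ C, v ≠ w → k ≤ hammingDist v w) ∧
      Fintype.card Y ^ m ≤ C.card * (m * Fintype.card Y + 1) ^ k := by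
  obtain ⟨C, hC⟩ := Set.Finite.exists_maximal
    (s := {C : Finset (Fin m → Y) | ∀ v ∈ C, ∀ w ∈ C, v ≠ w → k ≤ hammingDist v w})
    (Set.toFinite _) ⟨∅, by simp⟩
  refine ⟨C, hC.prop, ?_⟩
  -- A word outside all balls could be added to the maximal code.
  have hcover : (Finset.univ : Finset (Fin m → Y)) ⊆
      C.biUnion fun v => Finset.univ.filter fun w => hammingDist v w ≤ k := by
    intro w _
    simp only [Finset.mem_biUnion, Finset.mem_filter, Finset.mem_univ, true_and]
    by_contra! hw
    have hins : insert w C ∈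
        {C : Finset (Fin m → Y) | ∀ v ∈ C, ∀ w ∈ C, v ≠ w → k ≤ hammingDist v w} := by
      intro a ha b hb hab
      rcases Finset.mem_insert.1 ha with rfl | ha' <;>
        rcases Finset.mem_insert.1 hb with rfl | hb'
      · exact absurd rfl hab
      · rw [hammingDist_comm]; exact (hw b hb').le
      · exact (hw a ha').le
      · exact hC.prop a ha' b hb' hab
    have hwC : w ∈ C := hC.le_of_ge hins (Finset.subset_insert w C) (Finset.mem_insert_self w C)
    simpa using hw w hwC
  calc Fintype.card Y ^ m = (Finset.univ : Finset (Fin m → Y)).card := by simp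
    _ ≤ _ := Finset.card_le_card hcover
    _ ≤ _ := Finset.card_biUnion_le_card_mul _ _ _ fun v _ => card_hammingBall_le v k

/-! ### Product colouring and asymptotics -/

/-- Words over `Y` of length `m` at mutual distance at least `k` are coloured, with a colour for
each place and each letter of the words over the cycle, without a monochromatic odd cycle. -/
theorem pow_le_setRamsey_mul {Y ι : Type} [Fintype Y] [Fintype ι] {M l : ℕ} (q : Y → ι → ℤ)
    (hq : ∀ x y, x ≠ y → ∃ i, CycAdj M (q x i) (q y i)) (hl : 3 ≤ l) (hodd : Odd l) (hlM : l < M)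
    {r k m : ℕ} (hk : 1 ≤ k) (hm : m * Fintype.card ι ≤ r) :
    Fintype.card Y ^ m ≤ setRamsey r k (cycleGraph l) * (m * Fintype.card Y + 1) ^ k := by
  classical
  have : NeZero l := ⟨by omega⟩
  obtain ⟨C, hC, hcard⟩ := exists_code Y m k
  refine hcard.trans (Nat.mul_le_mul_right _ ?_)
  obtain ⟨emb⟩ : Nonempty (Fin m × ι ↪ Fin r) :=
    Function.Embedding.nonempty_of_card_le (by simpa using hm)
  rw [← Fintype.card_coe]
  refine (card_lt_setRamsey_cycleGraph hk hl
    (fun c (v w : C) => ∃ a i, emb (a, i) = c ∧ CycAdj M (q (v.1 a) i) (q (w.1 a) i))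
    ?_ ?_ ?_).le
  · rintro c v w ⟨a, i, h, h'⟩
    exact ⟨a, i, h, h'.symm⟩
  · intro v w hvw
    have hdist := hC v.1 v.2 w.1 w.2 (fun e => hvw (Subtype.ext e))
    have hex : ∀ a, ∃ i, v.1 a ≠ w.1 a → CycAdj M (q (v.1 a) i) (q (w.1 a) i) := by
      intro a
      by_cases ha : v.1 a = w.1 a
      -- Places of agreement only need a dummy index, borrowed from a place where the words differ.
      · obtain ⟨b, hb⟩ := Function.ne_iff.1 (fun e => hvw (Subtype.ext e))
        exact ⟨(hq _ _ hb).choose, fun h => absurd ha h⟩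
      · obtain ⟨i, hi⟩ := hq _ _ ha
        exact ⟨i, fun _ => hi⟩
    choose j hj using hex
    obtain ⟨s, hs, hsk⟩ := Finset.exists_subset_card_eq
      (s := (Finset.univ.filter fun a => v.1 a ≠ w.1 a).image fun a => emb (a, j a)) (n := k) (by
        rw [Finset.card_image_of_injective _ fun a b hab => congrArg Prod.fst (emb.injective hab)]
        exact hdist)
    refine ⟨s, hsk, fun c hc => ?_⟩
    obtain ⟨a, ha, rfl⟩ := Finset.mem_image.1 (hs hc)
    exact ⟨a, j a, rfl, hj a (Finset.mem_filter.1 ha).2⟩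
  · intro c f hf
    -- A colour determines its place and index, so the whole closed walk projects to one cycle.
    obtain ⟨a, i, hc, -⟩ := hf 0
    refine not_forall_cycAdj hodd hlM (fun j => q ((f j).1 a) i) fun j => ?_
    obtain ⟨a', i', hc', h⟩ := hf j
    obtain ⟨rfl, rfl⟩ := Prod.mk.inj (emb.injective (hc'.trans hc.symm))
    exact h

/-- A larger exponential outgrows a smaller one times a polynomial. -/
theorem eventually_pow_mul_pow_lt {γ β : ℝ} (hγ : 0 < γ) (hγβ : γ < β) (A : ℝ) (k : ℕ) :
    ∀ᶠ r : ℕ in atTop, γ ^ r * (A * (r : ℝ) ^ k) < β ^ r := by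
  have h1 : 1 < β / γ := (one_lt_div hγ).2 hγβ
  have ht := (tendsto_pow_const_div_const_pow_of_one_lt k h1).const_mul A
  rw [mul_zero] at ht
  filter_upwards [ht.eventually (gt_mem_nhds one_pos)] with r hr
  have hp : 0 < (β / γ) ^ r := by positivity
  rw [← mul_div_assoc, div_lt_one hp, div_pow, lt_div_iff₀ (by positivity)] at hr
  linarith

theorem proposition7p1 (ℓ : ℕ) (hℓ : 3 ≤ ℓ) (hodd : Odd ℓ) :
    ∃ ε : ℝ, 0 < ε ∧ ∃ f : ℝ, 1 < f ∧ ∀ k : ℕ, 2 ≤ k → ∀ᶠ r : ℕ in atTop,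
      (2 + ε) ^ ((r : ℝ) - f) * ((ℓ : ℝ) - 1) < (setRamsey r k (cycleGraph ℓ) : ℝ) := by
  -- The cycle has length `2 * ℓ + 3`, comfortably above `ℓ`.
  obtain ⟨Y, ι, _, _, _, q, hN, hq⟩ := exists_cycAdj_words ℓ
  set N := Fintype.card Y
  set d := Fintype.card ι
  have hd : 0 < d := Fintype.card_pos
  obtain ⟨β, hβ0, hβ⟩ : ∃ β : ℝ, 0 ≤ β ∧ β ^ d = N :=
    ⟨(N : ℝ) ^ (d⁻¹ : ℝ), by positivity, Real.rpow_inv_natCast_pow (by positivity) hd.ne'⟩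
  have hβ2 : 2 < β := by
    refine lt_of_pow_lt_pow_left₀ d hβ0 ?_
    rw [hβ, hN]
    push_cast
    linarith
  -- The base lies halfway between 2 and `β`; the gap absorbs all polynomial factors, so any `f > 1`
  -- would do.
  refine ⟨(β - 2) / 2, by linarith, 2, by norm_num, fun k hk => ?_⟩
  set γ : ℝ := 2 + (β - 2) / 2 with hγ
  have hγ2 : 2 < γ := by linarith
  filter_upwards [eventually_pow_mul_pow_lt (by linarith : 0 < γ) (by linarith : γ < β)
    (ℓ * ((N : ℝ) + 1) ^ k * β ^ d) k, eventually_ge_atTop 1] with r hr hr1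
  have hmd : r / d * d ≤ r := Nat.div_mul_le_self r d
  have hR := pow_le_setRamsey_mul (r := r) (k := k) q hq hℓ hodd (by omega) (by omega) hmd
  have hR' : (N : ℝ) ^ (r / d) ≤
      setRamsey r k (cycleGraph ℓ) * ((r / d : ℕ) * (N : ℝ) + 1) ^ k := by exact_mod_cast hR
  -- Rounding `r / d` down costs at most the constant `β ^ d`.
  have hNm : β ^ r ≤ (N : ℝ) ^ (r / d) * β ^ d := by
    rw [← hβ, ← pow_mul, ← pow_add]
    refine pow_le_pow_right₀ (by linarith) ?_
    have := Nat.lt_div_mul_add (a := r) hd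
    rw [mul_comm]
    omega
  have hball : ((r / d : ℕ) * (N : ℝ) + 1) ^ k ≤ ((N : ℝ) + 1) ^ k * (r : ℝ) ^ k := by
    rw [← mul_pow]
    refine pow_le_pow_left₀ (by positivity) ?_ k
    have h1 : ((r / d : ℕ) : ℝ) ≤ r := by exact_mod_cast Nat.div_le_self r d
    have h2 : (1 : ℝ) ≤ r := by exact_mod_cast hr1
    nlinarith [Nat.cast_nonneg (α := ℝ) N]
  have hexp : γ ^ ((r : ℝ) - 2) * ((ℓ : ℝ) - 1) ≤ γ ^ r * ℓ := by
    have h1 : γ ^ ((r : ℝ) - 2) ≤ γ ^ r := by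
      rw [← Real.rpow_natCast]
      exact Real.rpow_le_rpow_of_exponent_le (by linarith) (by linarith)
    have h2 : (3 : ℝ) ≤ ℓ := by exact_mod_cast hℓ
    exact mul_le_mul h1 (by linarith) (by linarith) (by positivity)
  refine hexp.trans_lt ?_
  have hpos : 0 < ((N : ℝ) + 1) ^ k * (r : ℝ) ^ k * β ^ d := by positivity
  refine lt_of_mul_lt_mul_right ?_ hpos.le
  calc γ ^ r * ℓ * (((N : ℝ) + 1) ^ k * (r : ℝ) ^ k * β ^ d)
      = γ ^ r * (ℓ * ((N : ℝ) + 1) ^ k * β ^ d * (r : ℝ) ^ k) := by ring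
    _ < β ^ r := hr
    _ ≤ (N : ℝ) ^ (r / d) * β ^ d := hNm
    _ ≤ setRamsey r k (cycleGraph ℓ) * (((N : ℝ) + 1) ^ k * (r : ℝ) ^ k) * β ^ d := by
        gcongr
        exact hR'.trans (by gcongr)
    _ = _ := by ring
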